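/- Let $\mathfrak{sv}$ be the Schrödinger–Virasoro algebra, that is, the complex Lie algebra with basis $\{L_n, M_n, Y_{n+\frac12} \mid n\in\mathbb{Z}\}$ and brackets $$[L_m,L_n]=(n-m)L_{m+n},\quad [L_m,M_n]=nM_{m+n},\quad [L_m,Y_{n+\frac12}]=\Bigl(n+\frac{1-m}{2}\Bigr)Y_{m+n+\frac12},$$ $$[Y_{m+\frac12},Y_{n+\frac12}]=(n-m)M_{m+n+1},\quad [M_m,M_n]=[M_m,Y_{n+\frac12}]=0,$$ and let $\mathfrak{sv}^+$ be the subalgebra spanned by all $L_n, M_n$ with $n\ge 1$ and all $Y_{m+\frac12}$ with $m\ge 0$. For a Lie algebra homomorphism $\psi:\mathfrak{sv}^+\to\mathbb{C}$ let $\mathbb{C}_\psi$ be the one-dimensional $\mathfrak{sv}^+$-module on which each $x\in\mathfrak{sv}^+$ acts as the scalar $\psi(x)$, let $W_\psi=U(\mathfrak{sv})\otimes_{U(\mathfrak{sv}^+)}\mathbb{C}_\psi$ be the induced $\mathfrak{sv}$-module (the universal Whittaker module of type $\psi$), and let $w=1\otimes 1\in W_\psi$. A vector $v$ of an $\mathfrak{sv}$-module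 is called a Whittaker vector of type $\psi$ if $xv=\psi(x)v$ for every $x\in\mathfrak{sv}^+$. Write $\mathbb{C}[M_0]\subset U(\mathfrak{sv})$ for the subalgebra generated by $M_0$. **Theorem 3.5.** Suppose $\psi$ is nonsingular, i.e. $\psi(M_1)\neq 0$. Then a vector $v\in W_\psi$ is a Whittaker vector of type $\psi$ if and only if $v=uw$ for some $u\in\mathbb{C}[M_0]$. Moreover, for every Lie algebra homomorphism $\psi':\mathfrak{sv}^+\to\mathbb{C}$ with $\psi'\neq\psi$, the module $W_\psi$ contains no nonzero Whittaker vector of type $\psi'$. -/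

import Mathlib

open scoped TensorProduct

noncomputable section

namespace SchrodingerVirasoro

/-- Index set of the standard basis: `L n`, `M n` stand for `L_n`, `M_n`, and `Y n` stands for
`Y_{n + 1/2}`, where `n` runs over the integers. -/
inductive Gen : Type
  | L (n : ℤ)
  | M (n : ℤ)
  | Y (n : ℤ)

/-- The underlying complex vector space of the Schrodinger-Virasoro algebra, with basis `Gen`. -/
def SV : Type := Gen →₀ ℂ

instance : AddCommGroup SV := inferInstanceAs (AddCommGroup (Gen →₀ ℂ))

instance : Module ℂ SV := inferInstanceAs (Module ℂ (Gen →₀ ℂ))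

/-- The basis vector attached to an index. -/
def gen (g : Gen) : SV := Finsupp.single g (1 : ℂ)

/-- The basis vector `L_n`. -/
def L (n : ℤ) : SV := gen (.L n)

/-- The basis vector `M_n`. -/
def M (n : ℤ) : SV := gen (.M n)

/-- The basis vector `Y_{n + 1/2}`. -/
def Y (n : ℤ) : SV := gen (.Y n)

/-- The Lie brackets of the basis vectors. -/
def bracketGen : Gen → Gen → SV
  | .L m, .L n => ((n : ℂ) - m) • L (m + n)
  | .L m, .M n => (n : ℂ) • M (m + n)
  | .L m, .Y n => ((n : ℂ) + (1 - m) / 2) • Y (m + n)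
  | .M n, .L m => -((n : ℂ) • M (m + n))
  | .Y n, .L m => -(((n : ℂ) + (1 - m) / 2) • Y (m + n))
  | .Y m, .Y n => ((n : ℂ) - m) • M (m + n + 1)
  | .M _, .M _ => 0
  | .M _, .Y _ => 0
  | .Y _, .M _ => 0

/-- The bilinear extension of `bracketGen`. -/
def bracket : SV →ₗ[ℂ] SV →ₗ[ℂ] SV :=
  Finsupp.linearCombination ℂ fun x => Finsupp.linearCombination ℂ (bracketGen x)

theorem bracket_gen (x y : Gen) : bracket (gen x) (gen y) = bracketGen x y := by
  unfold bracket gen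
  erw [Finsupp.linearCombination_single, one_smul]
  erw [Finsupp.linearCombination_single, one_smul]

theorem SV.induction {p : SV → Prop} (x : SV) (hzero : p 0) (hadd : ∀ x y, p x → p y → p (x + y))
    (hsmul : ∀ (c : ℂ) (g : Gen), p (c • gen g)) : p x := by
  refine Finsupp.induction_linear (motive := p) x hzero hadd fun g c => ?_
  have : (Finsupp.single g c : SV) = c • gen g := by
    unfold gen
    erw [Finsupp.smul_single, smul_eq_mul, mul_one]
  rw [this]
  exact hsmul c g

theorem bracketGen_skew (x y : Gen) : bracketGen x y = -bracketGen y x := by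
  rcases x with m | m | m <;> rcases y with n | n | n <;> simp [bracketGen]
  · rw [add_comm n m, ← neg_smul, neg_sub]
  · rw [add_comm n m, ← neg_smul, neg_sub]

theorem bracket_skew (x y : SV) : bracket x y = -bracket y x := by
  induction x using SV.induction with
  | hzero => simp
  | hadd a b ha hb => simp only [map_add, LinearMap.add_apply, ha, hb, neg_add]
  | hsmul c g =>
    induction y using SV.induction with
    | hzero => simp
    | hadd a b ha hb => simp only [map_add, LinearMap.add_apply, ha, hb, neg_add]
    | hsmul d h =>
      simp only [map_smul, LinearMap.smul_apply, bracket_gen, bracketGen_skew g h, smul_neg,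
        smul_comm c d]

theorem bracket_self (x : SV) : bracket x x = 0 := by
  have h := bracket_skew x x
  have h2 : (2 : ℂ) • bracket x x = 0 := by
    rw [two_smul]
    nth_rewrite 1 [h]
    exact neg_add_cancel _
  exact (smul_eq_zero.mp h2).resolve_left two_ne_zero

theorem bracket_jacobi_gen (x y z : Gen) :
    bracket (gen x) (bracket (gen y) (gen z)) =
      bracket (bracket (gen x) (gen y)) (gen z) + bracket (gen y) (bracket (gen x) (gen z)) := by
  rcases x with a | a | a <;> rcases y with b | b | b <;> rcases z with c | c | c <;>
    simp only [bracket_gen, bracketGen, map_smul, map_neg, map_zero, LinearMap.smul_apply,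
      LinearMap.neg_apply, LinearMap.zero_apply, L, M, Y, smul_zero, add_zero, neg_zero,
      smul_neg, neg_neg, smul_smul]
  all_goals (push_cast; ring_nf; try module)

theorem bracket_jacobi (x y z : SV) :
    bracket x (bracket y z) = bracket (bracket x y) z + bracket y (bracket x z) := by
  induction x using SV.induction with
  | hzero => simp
  | hadd a b ha hb =>
    simp only [map_add, LinearMap.add_apply, ha, hb]
    abel
  | hsmul c f =>
    induction y using SV.induction with
    | hzero => simp
    | hadd a b ha hb =>
      simp only [map_add, LinearMap.add_apply, ha, hb]
      abel
    | hsmul d g =>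
      induction z using SV.induction with
      | hzero => simp
      | hadd a b ha hb =>
        simp only [map_add, ha, hb]
        abel
      | hsmul e h =>
        simp only [map_smul, LinearMap.smul_apply, bracket_jacobi_gen f g h]
        module

/-- The Schrodinger-Virasoro Lie algebra. -/
instance : LieRing SV where
  bracket x y := bracket x y
  add_lie x y z := by simp
  lie_add x y z := by simp
  lie_self x := bracket_self x
  leibniz_lie x y z := bracket_jacobi x y z

instance : LieAlgebra ℂ SV where
  lie_smul c x y := (bracket x).map_smul c y

theorem lie_gen (x y : Gen) : ⁅gen x, gen y⁆ = bracketGen x y := bracket_gen x y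

/-- The indices of the basis vectors `L_n`, `M_n` with `n > 0` and `Y_{n + 1/2}` with `n ≥ 0`. -/
def Gen.IsPos : Gen → Prop
  | .L n => 0 < n
  | .M n => 0 < n
  | .Y n => 0 ≤ n

/-- The positive part `sv⁺`: the span of all `L_n`, `M_n` with `n > 0` and all `Y_{n + 1/2}` with
`n ≥ 0`. -/
def svPlus : LieSubalgebra ℂ SV where
  toSubmodule := Submodule.span ℂ (gen '' {g | g.IsPos})
  lie_mem' := by
    intro x y hx hy
    change x ∈ Submodule.span ℂ (gen '' {g | g.IsPos}) at hx
    change y ∈ Submodule.span ℂ (gen '' {g | g.IsPos}) at hy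
    change bracket x y ∈ Submodule.span ℂ (gen '' {g | g.IsPos})
    have key : ∀ g : Gen, g.IsPos → gen g ∈ Submodule.span ℂ (gen '' {g | g.IsPos}) :=
      fun g hg => Submodule.subset_span ⟨g, hg, rfl⟩
    induction hx, hy using Submodule.span_induction₂ with
    | mem_mem a b ha hb =>
      obtain ⟨g, hg, rfl⟩ := ha
      obtain ⟨h, hh, rfl⟩ := hb
      rw [bracket_gen]
      rcases g with m | m | m <;> rcases h with n | n | n <;>
        simp only [Set.mem_ofPred_eq, Gen.IsPos] at hg hh <;>
        simp only [bracketGen, Submodule.zero_mem, Submodule.neg_mem_iff] <;>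
        refine Submodule.smul_mem _ _ (key _ ?_) <;>
        simp only [Gen.IsPos] <;> omega
    | zero_left => simp
    | zero_right => simp
    | add_left a b c _ _ _ h1 h2 => simpa using Submodule.add_mem _ h1 h2
    | add_right a b c _ _ _ h1 h2 => simpa using Submodule.add_mem _ h1 h2
    | smul_left r a b _ _ h => simpa using Submodule.smul_mem _ r h
    | smul_right r a b _ _ h => simpa using Submodule.smul_mem _ r h

/-- `M_1` as an element of `sv⁺`. -/
def M1 : svPlus := ⟨M 1, Submodule.subset_span ⟨.M 1, Int.one_pos, rfl⟩⟩

/-- The Lie algebra homomorphism `ψ : sv⁺ → ℂ` is nonsingular if `ψ (M_1) ≠ 0`. -/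
def IsNonsingular (ψ : LieAlgebra.LieCharacter ℂ svPlus) : Prop := ψ M1 ≠ 0

/-- The universal enveloping algebra `U(sv)`. -/
abbrev U : Type := UniversalEnvelopingAlgebra ℂ SV

/-- The universal enveloping algebra `U(sv⁺)`. -/
abbrev UPlus : Type := UniversalEnvelopingAlgebra ℂ svPlus

section

attribute [local instance] LieRing.ofAssociativeRing

/-- The algebra homomorphism `U(sv⁺) → U(sv)` induced by the inclusion `sv⁺ → sv`. -/
def inclU : UPlus →ₐ[ℂ] U :=
  UniversalEnvelopingAlgebra.lift ℂ ((UniversalEnvelopingAlgebra.ι ℂ).comp svPlus.incl)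

end

section TensorProductOverNoncommutativeRing

variable {A B : Type} [Ring A] [Algebra ℂ A] [Ring B] [Algebra ℂ B] (f : B →ₐ[ℂ] A)
  (N : Type) [AddCommGroup N] [Module ℂ N] [Module B N]

/-- The `A`-submodule of `A ⊗_ℂ N` generated by the elements `a f(b) ⊗ n - a ⊗ b n`. As these
elements are stable under multiplication by `A` from the left, it is also their additive span. -/
def balancingSubmodule : Submodule A (A ⊗[ℂ] N) :=
  Submodule.span A {t | ∃ (a : A) (b : B) (n : N), t = (a * f b) ⊗ₜ[ℂ] n - a ⊗ₜ[ℂ] (b • n)}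

/-- The tensor product `A ⊗_B N` of left `A`-modules, where `A` is a right `B`-module
through `f : B → A`. -/
abbrev InducedModule : Type := (A ⊗[ℂ] N) ⧸ balancingSubmodule f N

end TensorProductOverNoncommutativeRing

/-- The one-dimensional `sv⁺`-module `ℂ_ψ`: the space `ℂ` on which `x` acts as `ψ x`. -/
def CPsi (_ψ : LieAlgebra.LieCharacter ℂ svPlus) : Type := ℂ

section Modules

variable (ψ : LieAlgebra.LieCharacter ℂ svPlus)

instance : AddCommGroup (CPsi ψ) := inferInstanceAs (AddCommGroup ℂ)

instance : Module ℂ (CPsi ψ) := inferInstanceAs (Module ℂ ℂ)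

/-- `ℂ_ψ` as a module over `U(sv⁺)`: the action of `sv⁺` through `ψ`, extended to `U(sv⁺)`. -/
instance : Module UPlus (CPsi ψ) :=
  Module.compHom ℂ (UniversalEnvelopingAlgebra.lift ℂ ψ : UPlus →ₐ[ℂ] ℂ).toRingHom

/-- The element `1` of `ℂ_ψ`. -/
def CPsi.one : CPsi ψ := (1 : ℂ)

/-- The universal Whittaker module `W_ψ = U(sv) ⊗_{U(sv⁺)} ℂ_ψ`. -/
def W : Type := InducedModule inclU (CPsi ψ)

instance : AddCommGroup (W ψ) := inferInstanceAs (AddCommGroup (InducedModule inclU (CPsi ψ)))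

instance : Module ℂ (W ψ) := inferInstanceAs (Module ℂ (InducedModule inclU (CPsi ψ)))

instance : Module U (W ψ) := inferInstanceAs (Module U (InducedModule inclU (CPsi ψ)))

instance : IsScalarTower ℂ U (W ψ) :=
  inferInstanceAs (IsScalarTower ℂ U (InducedModule inclU (CPsi ψ)))

/-- `W_ψ` as a module over the Lie algebra `sv`. -/
instance : LieRingModule SV (W ψ) where
  bracket x v := UniversalEnvelopingAlgebra.ι ℂ x • v
  add_lie x y v := by simp only [map_add, add_smul]
  lie_add x v v' := smul_add _ v v'
  leibniz_lie x y v := by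
    change UniversalEnvelopingAlgebra.ι ℂ x • UniversalEnvelopingAlgebra.ι ℂ y • v =
      UniversalEnvelopingAlgebra.ι ℂ ⁅x, y⁆ • v +
        UniversalEnvelopingAlgebra.ι ℂ y • UniversalEnvelopingAlgebra.ι ℂ x • v
    let _ : LieRing U := LieRing.ofAssociativeRing
    rw [LieHom.map_lie, LieRing.of_associative_ring_bracket, sub_smul, mul_smul, mul_smul,
      sub_add_cancel]

theorem lie_W (x : SV) (v : W ψ) : ⁅x, v⁆ = UniversalEnvelopingAlgebra.ι ℂ x • v := rfl

instance : LieModule ℂ SV (W ψ) where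
  smul_lie c x v := by simp only [lie_W, map_smul, smul_assoc]
  lie_smul c x v := by
    simp only [lie_W]
    rw [← algebraMap_smul U c v, ← algebraMap_smul U c, smul_smul, smul_smul, Algebra.commutes]

/-- The cyclic vector `w = 1 ⊗ 1` of `W_ψ`. -/
def w : W ψ := Submodule.Quotient.mk ((1 : U) ⊗ₜ[ℂ] CPsi.one ψ)

end Modules

/-- A vector `v` of an `sv`-module is a Whittaker vector of type `ψ` if `x v = ψ(x) v` for
every `x` in `sv⁺`. -/
def IsWhittakerVector {V : Type*} [AddCommGroup V] [Module ℂ V] [LieRingModule SV V]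
    [LieModule ℂ SV V] (ψ : LieAlgebra.LieCharacter ℂ svPlus) (v : V) : Prop :=
  ∀ x : svPlus, ⁅(x : SV), v⁆ = ψ x • v

/-- The subalgebra `ℂ[M_0]` of `U(sv)` generated by `M_0`. -/
def polyM0 : Subalgebra ℂ U := Algebra.adjoin ℂ {UniversalEnvelopingAlgebra.ι ℂ (M 0)}

end SchrodingerVirasoro

end

noncomputable section

namespace SchrodingerVirasoro

/-! ### Weights of the basis vectors -/

/-! Filter `W ψ` by applying to `w` the words in nonpositive basis vectors of total weight at most
`N`. Two such basis vectors commute up to an operator of smaller weight, so on leading terms a word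
behaves like a commutative monomial. For `z ≠ M_0` the weights are chosen so that `z.dual - ψ
(z.dual)` lowers the filtration by the weight of `z`. Since `[z.dual, z] = c M_1` and `M_1` acts as
`ψ(M_1) ≠ 0` up to lower weight, this operator acts on leading terms as `c ψ(M_1) ∂/∂z`.

The Euler operator, the sum over `z` of `weight z / (c ψ(M_1)) · z (z.dual - ψ (z.dual))`, therefore
multiplies leading terms of weight `N` by `N` (`exists_euler_mem`). It kills Whittaker vectors of
type `ψ`, so these descend to weight 0, where only powers of `M_0` remain. The converse holds
because `M_0` is central.

For type `ψ' ≠ ψ`, some `x - ψ x` acts on the vector by the nonzero scalar `ψ' x - ψ x` and yet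
lowers the filtration, which is zero in negative weight. Only spanning by words is needed, never
their linear independence. -/

/-- The weight of a basis vector of nonpositive index. -/
def Gen.weight : Gen → ℤ
  | .L n => 4 - 2 * n
  | .M n => -2 * n
  | .Y n => 1 - 2 * n

/-- The amount by which `x - ψ x` lowers the weight, for `x` a basis vector of `sv⁺`. -/
def Gen.drop : Gen → ℤ
  | .L n => max 1 (2 * n - 2)
  | .M n => 2 * n + 2
  | .Y n => 2 * n + 1

/-- The order of a basis vector as an operator on a weighted module. -/
def Gen.order : Gen → ℤ
  | .L n => if n ≤ 0 then 4 - 2 * n else if n ≤ 2 then 0 else 2 - 2 * n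
  | .M n => if n ≤ 0 then -2 * n else if n = 1 then 0 else -2 - 2 * n
  | .Y n => if n < 0 then 1 - 2 * n else if n ≤ 1 then 0 else -1 - 2 * n

/-- The basis vector of `sv⁺` whose bracket with the given one is a multiple of `M_1`. -/
def Gen.dual : Gen → Gen
  | .L n => .M (1 - n)
  | .M n => .L (1 - n)
  | .Y n => .Y (-n)

/-- The coefficient of `M_1` in the bracket of `dual g` with `g`. -/
def Gen.dualCoeff : Gen → ℂ
  | .L n => n - 1
  | .M n => n
  | .Y n => 2 * n

theorem Gen.order_eq_weight {g : Gen} (hg : ¬ g.IsPos) : g.order = g.weight := by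
  rcases g with n | n | n <;> simp only [IsPos, not_lt, not_le] at hg <;> simp [order, weight, hg]

theorem Gen.weight_nonneg {g : Gen} (hg : ¬ g.IsPos) : 0 ≤ g.weight := by
  rcases g with n | n | n <;> simp only [IsPos, not_lt, not_le] at hg <;> simp only [weight] <;>
    omega

theorem Gen.eq_of_weight_le_zero {g : Gen} (hg : ¬ g.IsPos) (h : g.weight ≤ 0) : g = .M 0 := by
  rcases g with n | n | n <;> simp only [IsPos, not_lt, not_le, weight] at hg h
  · omega
  · congr 1; omega
  · omega

theorem Gen.drop_pos {g : Gen} (hg : g.IsPos) : 1 ≤ g.drop := by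
  rcases g with n | n | n <;> simp only [IsPos] at hg <;> simp only [drop] <;> omega

theorem Gen.isPos_dual {g : Gen} (hg : ¬ g.IsPos) : g.dual.IsPos := by
  rcases g with n | n | n <;> simp only [IsPos, not_lt, not_le] at hg <;>
    simp only [dual, IsPos] <;> omega

theorem Gen.drop_dual {g : Gen} (hg : ¬ g.IsPos) (h0 : g.weight ≠ 0) : g.dual.drop = g.weight := by
  rcases g with n | n | n <;> simp only [IsPos, not_lt, not_le, weight] at hg h0 <;>
    simp only [dual, weight, drop] <;> omega

theorem Gen.dualCoeff_ne_zero {g : Gen} (hg : ¬ g.IsPos) (h0 : g.weight ≠ 0) :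
    g.dualCoeff ≠ 0 := by
  rcases g with n | n | n <;> simp only [IsPos, not_lt, not_le, weight] at hg h0 <;>
    simp only [dualCoeff]
  · exact_mod_cast (by omega : n - 1 ≠ 0)
  · exact_mod_cast (by omega : n ≠ 0)
  · exact_mod_cast (by omega : 2 * n ≠ 0)

theorem bracketGen_dual (g : Gen) : bracketGen g.dual g = g.dualCoeff • M 1 := by
  rcases g with n | n | n <;> simp only [Gen.dual, Gen.dualCoeff, bracketGen]
  · rw [← neg_smul]
    congr 2
    · push_cast; ring
    · ring
  · congr 2; ring
  · congr 2
    · push_cast; ring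
    · ring

/-- The span of the basis vectors of order at most `k`. -/
def orderFilt (k : ℤ) : Submodule ℂ SV := Submodule.span ℂ (gen '' {g | g.order ≤ k})

theorem gen_mem_orderFilt {g : Gen} {k : ℤ} (h : g.order ≤ k) : gen g ∈ orderFilt k :=
  Submodule.subset_span ⟨g, h, rfl⟩

theorem bracketGen_mem_orderFilt {x y : Gen} (hx : x.IsPos) (hy : ¬ y.IsPos) :
    bracketGen x y ∈ orderFilt (y.weight - x.drop) := by
  rcases x with m | m | m <;> rcases y with n | n | n <;>
    simp only [Gen.IsPos, not_lt, not_le] at hx hy <;>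
    simp only [bracketGen, Submodule.zero_mem, Submodule.neg_mem_iff] <;>
    -- The vanishing of `[L_m, M_0]` matters: for `m = 1` the order 0 of `M_1` would exceed the
    -- bound.
    rcases eq_or_ne n 0 with rfl | hn <;>
    (try simp only [Int.cast_zero, zero_smul, Submodule.zero_mem]) <;>
    refine Submodule.smul_mem _ _ (gen_mem_orderFilt ?_) <;>
    simp only [Gen.order, Gen.weight, Gen.drop] <;> split_ifs <;> omega

/-- On leading terms `z.dual` differentiates in the variable `z` alone: every other letter
contributes strictly lower weight. -/
theorem bracketGen_dual_mem_orderFilt {y z : Gen} (hy : ¬ y.IsPos) (hz : ¬ z.IsPos)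
    (hyz : y ≠ z) (h0 : z.weight ≠ 0) :
    bracketGen z.dual y ∈ orderFilt (y.weight - z.weight - 1) := by
  rcases z with m | m | m <;> rcases y with n | n | n <;>
    simp only [Gen.IsPos, not_lt, not_le, Gen.weight, ne_eq, Gen.L.injEq, Gen.M.injEq,
      Gen.Y.injEq] at hy hz hyz h0 <;>
    simp only [Gen.dual, bracketGen, Submodule.zero_mem, Submodule.neg_mem_iff] <;>
    refine Submodule.smul_mem _ _ (gen_mem_orderFilt ?_) <;>
    simp only [Gen.order, Gen.weight] <;> split_ifs <;> omega

/-- Letters of a word may be permuted modulo lower weight. -/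
theorem bracketGen_mem_orderFilt_of_not_isPos {y z : Gen} (hy : ¬ y.IsPos) (hz : ¬ z.IsPos) :
    bracketGen z y ∈ orderFilt (z.weight + y.weight - 1) := by
  rcases z with m | m | m <;> rcases y with n | n | n <;>
    simp only [Gen.IsPos, not_lt, not_le] at hy hz <;>
    simp only [bracketGen, Submodule.zero_mem, Submodule.neg_mem_iff] <;>
    refine Submodule.smul_mem _ _ (gen_mem_orderFilt ?_) <;>
    simp only [Gen.order, Gen.weight] <;> split_ifs <;> omega

/-! ### Values of a character on the basis vectors -/

theorem gen_mem_svPlus {g : Gen} (hg : g.IsPos) : gen g ∈ svPlus :=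
  Submodule.subset_span ⟨g, hg, rfl⟩

open Classical in
/-- The value of a character of `sv⁺` on a basis vector, extended by zero. -/
def genValue (ψ : LieAlgebra.LieCharacter ℂ svPlus) (g : Gen) : ℂ :=
  if h : g.IsPos then ψ ⟨gen g, gen_mem_svPlus h⟩ else 0

theorem genValue_of_isPos (ψ : LieAlgebra.LieCharacter ℂ svPlus) {g : Gen} (h : g.IsPos) :
    genValue ψ g = ψ ⟨gen g, gen_mem_svPlus h⟩ := dif_pos h

theorem genValue_eq_zero_of_bracket (ψ : LieAlgebra.LieCharacter ℂ svPlus) {x y g : Gen}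
    (hx : x.IsPos) (hy : y.IsPos) (hg : g.IsPos) {c : ℂ} (hc : c ≠ 0)
    (h : bracketGen x y = c • gen g) : genValue ψ g = 0 := by
  have h1 := LieAlgebra.lieCharacter_apply_lie ψ ⟨gen x, gen_mem_svPlus hx⟩
    ⟨gen y, gen_mem_svPlus hy⟩
  have h2 : (⁅(⟨gen x, gen_mem_svPlus hx⟩ : svPlus), (⟨gen y, gen_mem_svPlus hy⟩ : svPlus)⁆
      : svPlus) = c • ⟨gen g, gen_mem_svPlus hg⟩ :=
    Subtype.ext ((lie_gen x y).trans h)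
  rw [h2, map_smul, smul_eq_mul] at h1
  rw [genValue_of_isPos ψ hg]
  exact (mul_eq_zero.mp h1).resolve_left hc

/-- Negative order occurs only for `L_n` with `n ≥ 3` and for `M_n`, `Y_{n+1/2}` with `n ≥ 2`. Each
is a nonzero multiple of the bracket of `L_1` with its predecessor, and characters kill brackets. -/
theorem genValue_eq_zero_of_order_neg (ψ : LieAlgebra.LieCharacter ℂ svPlus) {g : Gen}
    (hg : g.order < 0) : genValue ψ g = 0 := by
  rcases g with n | n | n <;> simp only [Gen.order] at hg <;> split_ifs at hg <;> try omega
  · refine genValue_eq_zero_of_bracket ψ (x := .L 1) (y := .L (n - 1)) (c := n - 2) ?_ ?_ ?_ ?_ ?_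
    any_goals simp only [Gen.IsPos]; omega
    · exact_mod_cast (by omega : n - 2 ≠ 0)
    · simp only [bracketGen, add_sub_cancel, L]
      congr 1
      push_cast; ring
  · refine genValue_eq_zero_of_bracket ψ (x := .L 1) (y := .M (n - 1)) (c := n - 1) ?_ ?_ ?_ ?_ ?_
    any_goals simp only [Gen.IsPos]; omega
    · exact_mod_cast (by omega : n - 1 ≠ 0)
    · simp only [bracketGen, add_sub_cancel, M]
      congr 1
      push_cast; ring
  · refine genValue_eq_zero_of_bracket ψ (x := .L 1) (y := .Y (n - 1)) (c := n - 1) ?_ ?_ ?_ ?_ ?_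
    any_goals simp only [Gen.IsPos]; omega
    · exact_mod_cast (by omega : n - 1 ≠ 0)
    · simp only [bracketGen, add_sub_cancel, Y]
      congr 1
      push_cast; ring

theorem lieCharacter_ext_genValue {ψ ψ' : LieAlgebra.LieCharacter ℂ svPlus}
    (h : ∀ g : Gen, g.IsPos → genValue ψ g = genValue ψ' g) : ψ = ψ' := by
  let _ : LieRing ℂ := LieRing.ofAssociativeRing
  refine LieHom.ext fun ⟨x, hx⟩ => ?_
  change x ∈ Submodule.span ℂ (gen '' {g | g.IsPos}) at hx
  induction hx using Submodule.span_induction with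
  | mem x hx =>
    obtain ⟨g, hg, rfl⟩ := hx
    simpa only [genValue_of_isPos _ hg] using h g hg
  | zero => exact (map_zero ψ).trans (map_zero ψ').symm
  | add x y hx hy h1 h2 =>
    exact (map_add ψ ⟨x, hx⟩ ⟨y, hy⟩).trans
      ((congrArg₂ (· + ·) h1 h2).trans (map_add ψ' ⟨x, hx⟩ ⟨y, hy⟩).symm)
  | smul c x hx h1 =>
    exact (map_smul ψ c ⟨x, hx⟩).trans
      ((congrArg (c • ·) h1).trans (map_smul ψ' c ⟨x, hx⟩).symm)

/-! ### The weight filtration of a module with a Whittaker vector -/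

section Filtration

variable {V : Type*} [AddCommGroup V] [Module ℂ V] [LieRingModule SV V]

/-- The result of applying a word of basis vectors to `w`. -/
def wordAct (w : V) (l : List Gen) : V := l.foldr (fun g v => ⁅gen g, v⁆) w

/-- The total weight of a word. -/
def wordWeight (l : List Gen) : ℤ := (l.map Gen.weight).sum

theorem wordWeight_cons (g : Gen) (l : List Gen) :
    wordWeight (g :: l) = g.weight + wordWeight l := by simp [wordWeight]

theorem wordWeight_nonneg {l : List Gen} (hl : ∀ g ∈ l, ¬ g.IsPos) : 0 ≤ wordWeight l :=
  List.sum_nonneg (by simpa using fun g hg => Gen.weight_nonneg (hl g hg))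

/-- The span of the words of nonpositive basis vectors of weight at most `N`, applied to `w`. -/
def weightFilt (w : V) (N : ℤ) : Submodule ℂ V :=
  Submodule.span ℂ {v | ∃ l : List Gen, (∀ g ∈ l, ¬ g.IsPos) ∧ wordWeight l ≤ N ∧ wordAct w l = v}

theorem weightFilt_mono (w : V) {N N' : ℤ} (h : N ≤ N') : weightFilt w N ≤ weightFilt w N' :=
  Submodule.span_mono fun _ ⟨l, hl, hN, hv⟩ => ⟨l, hl, hN.trans h, hv⟩

theorem wordAct_mem_weightFilt (w : V) {l : List Gen} (hl : ∀ g ∈ l, ¬ g.IsPos) {N : ℤ}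
    (hN : wordWeight l ≤ N) : wordAct w l ∈ weightFilt w N :=
  Submodule.subset_span ⟨l, hl, hN, rfl⟩

theorem weightFilt_eq_bot (w : V) {N : ℤ} (hN : N < 0) : weightFilt w N = ⊥ := by
  refine Submodule.span_eq_bot.mpr ?_
  rintro _ ⟨l, hl, hlN, -⟩
  have := wordWeight_nonneg hl
  omega

/-- A linear condition on a vector of the filtration holds if it holds for words. -/
theorem map_mem_of_wordAct {w : V} {N : ℤ} {P : Submodule ℂ V} (f : V →ₗ[ℂ] V)
    (h : ∀ l : List Gen, (∀ g ∈ l, ¬ g.IsPos) → wordWeight l ≤ N → f (wordAct w l) ∈ P)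
    {v : V} (hv : v ∈ weightFilt w N) : f v ∈ P := by
  have : weightFilt w N ≤ P.comap f := by
    refine Submodule.span_le.mpr ?_
    rintro _ ⟨l, hl, hN, rfl⟩
    exact h l hl hN
  exact this hv

/-! ### Action of the algebra on the filtration -/

variable [LieModule ℂ SV V]

/-- The operator `x - c` on a module. -/
def shifted (x : SV) (c : ℂ) : V →ₗ[ℂ] V := LieModule.toEnd ℂ SV V x - c • LinearMap.id

theorem shifted_apply (x : SV) (c : ℂ) (v : V) : shifted x c v = ⁅x, v⁆ - c • v := rfl

theorem shifted_lie (x y : SV) (c : ℂ) (v : V) :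
    shifted x c ⁅y, v⁆ = ⁅⁅x, y⁆, v⁆ + ⁅y, shifted x c v⁆ := by
  simp only [shifted_apply, leibniz_lie x y v, lie_sub, lie_smul, add_sub_assoc]

theorem lie_mem_weightFilt_of_not_isPos {w : V} {g : Gen} (hg : ¬ g.IsPos) {N : ℤ} {v : V}
    (hv : v ∈ weightFilt w N) : ⁅gen g, v⁆ ∈ weightFilt w (g.weight + N) := by
  refine map_mem_of_wordAct (LieModule.toEnd ℂ SV V (gen g)) (fun l hl hN => ?_) hv
  refine wordAct_mem_weightFilt w (l := g :: l) ?_ ?_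
  · simpa using ⟨hg, hl⟩
  · rw [wordWeight_cons]; omega

theorem lie_mem_of_mem_orderFilt {v : V} {P : Submodule ℂ V} {k : ℤ}
    (h : ∀ g : Gen, g.order ≤ k → ⁅gen g, v⁆ ∈ P) {x : SV} (hx : x ∈ orderFilt k) :
    ⁅x, v⁆ ∈ P := by
  let f : SV →ₗ[ℂ] V :=
    { toFun := fun x => ⁅x, v⁆
      map_add' := fun a b => add_lie a b v
      map_smul' := fun c a => smul_lie c a v }
  have : orderFilt k ≤ P.comap f := by
    refine Submodule.span_le.mpr ?_
    rintro _ ⟨g, hg, rfl⟩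
    exact h g hg
  exact this hx

theorem Gen.neg_drop_le_order {g : Gen} (hg : g.IsPos) : -g.drop ≤ g.order := by
  rcases g with n | n | n <;> simp only [IsPos] at hg <;> simp only [drop, order] <;>
    split_ifs <;> omega

variable (ψ : LieAlgebra.LieCharacter ℂ svPlus) {w : V}

/-- Split a positive `x` as `(x - ψ x) + ψ x`; the scalar vanishes whenever the order is negative.
The bound on `x - ψ x` is assumed for this one word only, so that the lemma can serve inside the
induction that proves the bound. -/
theorem lie_wordAct_mem_weightFilt {l : List Gen} (hl : ∀ g ∈ l, ¬ g.IsPos)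
    (h : ∀ x : Gen, x.IsPos →
      shifted (gen x) (genValue ψ x) (wordAct w l) ∈ weightFilt w (wordWeight l - x.drop))
    (g : Gen) : ⁅gen g, wordAct w l⁆ ∈ weightFilt w (wordWeight l + g.order) := by
  by_cases hg : g.IsPos
  · have h1 := weightFilt_mono w (N' := wordWeight l + g.order)
      (by have := Gen.neg_drop_le_order hg; omega) (h g hg)
    rw [shifted_apply] at h1
    refine (Submodule.sub_mem_iff_left _ ?_).mp h1
    by_cases h0 : g.order < 0
    · rw [genValue_eq_zero_of_order_neg ψ h0, zero_smul]
      exact Submodule.zero_mem _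
    · exact Submodule.smul_mem _ _ (wordAct_mem_weightFilt w hl (by omega))
  · rw [Gen.order_eq_weight hg, add_comm]
    exact lie_mem_weightFilt_of_not_isPos hg (wordAct_mem_weightFilt w hl le_rfl)

variable {ψ}

theorem IsWhittakerVector.shifted_eq_zero {v : V} (hv : IsWhittakerVector ψ v) {g : Gen}
    (hg : g.IsPos) : shifted (gen g) (genValue ψ g) v = 0 := by
  rw [shifted_apply, genValue_of_isPos ψ hg, sub_eq_zero]
  exact hv ⟨gen g, gen_mem_svPlus hg⟩

/-- Induction on the word, moving `x - ψ x` past the first letter `y`. The hypothesis is needed for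
all positive basis vectors at once, since `[x, y]` may itself be positive. -/
theorem shifted_wordAct_mem_weightFilt (hw : IsWhittakerVector ψ w) {l : List Gen}
    (hl : ∀ g ∈ l, ¬ g.IsPos) {x : Gen} (hx : x.IsPos) :
    shifted (gen x) (genValue ψ x) (wordAct w l) ∈ weightFilt w (wordWeight l - x.drop) := by
  induction l generalizing x with
  | nil =>
    change shifted (gen x) (genValue ψ x) w ∈ _
    rw [hw.shifted_eq_zero hx]
    exact Submodule.zero_mem _
  | cons y l ih =>
    simp only [List.mem_cons, forall_eq_or_imp] at hl
    have ih := fun {x : Gen} (hx : x.IsPos) => ih hl.2 hx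
    change shifted (gen x) (genValue ψ x) ⁅gen y, wordAct w l⁆ ∈ _
    rw [shifted_lie, lie_gen, wordWeight_cons]
    refine Submodule.add_mem _ ?_ ?_
    · refine lie_mem_of_mem_orderFilt (fun g hg => ?_) (bracketGen_mem_orderFilt hx hl.1)
      exact weightFilt_mono w (by omega)
        (lie_wordAct_mem_weightFilt ψ hl.2 (fun x hx => ih hx) g)
    · exact weightFilt_mono w (by omega) (lie_mem_weightFilt_of_not_isPos hl.1 (ih hx))

theorem shifted_mem_weightFilt (hw : IsWhittakerVector ψ w) {x : Gen} (hx : x.IsPos) {N : ℤ}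
    {v : V} (hv : v ∈ weightFilt w N) :
    shifted (gen x) (genValue ψ x) v ∈ weightFilt w (N - x.drop) :=
  map_mem_of_wordAct _ (fun _ hl hN => weightFilt_mono w (by omega)
    (shifted_wordAct_mem_weightFilt hw hl hx)) hv

theorem lie_mem_weightFilt (hw : IsWhittakerVector ψ w) {k N : ℤ} {x : SV} {v : V}
    (hx : x ∈ orderFilt k) (hv : v ∈ weightFilt w N) : ⁅x, v⁆ ∈ weightFilt w (N + k) := by
  refine lie_mem_of_mem_orderFilt (fun g hg => ?_) hx
  exact map_mem_of_wordAct (LieModule.toEnd ℂ SV V (gen g)) (fun l hl hN =>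
    weightFilt_mono w (by omega) (lie_wordAct_mem_weightFilt ψ hl
      (fun x hx => shifted_wordAct_mem_weightFilt hw hl hx) g)) hv

/-! ### The Euler operator -/

variable (ψ) in
/-- The summand of the Euler operator attached to a basis vector. -/
def eulerTerm (z : Gen) : V →ₗ[ℂ] V :=
  (z.weight / (z.dualCoeff * genValue ψ (.M 1)) : ℂ) •
    LieModule.toEnd ℂ SV V (gen z) ∘ₗ shifted (gen z.dual) (genValue ψ z.dual)

theorem eulerTerm_apply (z : Gen) (v : V) : eulerTerm ψ z v =
    (z.weight / (z.dualCoeff * genValue ψ (.M 1)) : ℂ) •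
      ⁅gen z, shifted (gen z.dual) (genValue ψ z.dual) v⁆ := rfl

-- The commutator of the summand at `z` with a letter `y` is `weight y · y` if `y = z` and 0
-- otherwise, modulo lower weight. Summed over `z`, this is the derivation property of an Euler
-- operator.
open Classical in
theorem eulerTerm_lie_mem (hψ : genValue ψ (.M 1) ≠ 0) (hw : IsWhittakerVector ψ w) {y z : Gen}
    (hy : ¬ y.IsPos) (hz : ¬ z.IsPos) {N : ℤ} {v : V} (hv : v ∈ weightFilt w N) :
    eulerTerm ψ z ⁅gen y, v⁆ - ⁅gen y, eulerTerm ψ z v⁆ -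
      (if y = z then (y.weight : ℂ) else 0) • ⁅gen y, v⁆ ∈ weightFilt w (y.weight + N - 1) := by
  by_cases h0 : z.weight = 0
  · have h1 : (if y = z then (y.weight : ℂ) else 0) = 0 := by
      split_ifs with h
      · rw [h, h0, Int.cast_zero]
      · rfl
    -- Here `z = M_0`: its weight is the numerator of the coefficient, so the summand is zero even
    -- though `dualCoeff` vanishes too.
    simp [eulerTerm_apply, h0, h1]
  have hd := Gen.isPos_dual hz
  have hsv := shifted_mem_weightFilt hw hd hv
  rw [Gen.drop_dual hz h0] at hsv
  have h1 := lie_mem_weightFilt hw (bracketGen_mem_orderFilt_of_not_isPos hy hz) hsv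
  rw [← lie_gen] at h1
  replace h1 := weightFilt_mono w (N' := y.weight + N - 1) (by omega) h1
  set e : ℂ := z.weight / (z.dualCoeff * genValue ψ (.M 1)) with he
  have key : eulerTerm ψ z ⁅gen y, v⁆ - ⁅gen y, eulerTerm ψ z v⁆ =
      e • ⁅⁅gen z, gen y⁆, shifted (gen z.dual) (genValue ψ z.dual) v⁆ +
      e • ⁅gen z, ⁅⁅gen z.dual, gen y⁆, v⁆⁆ := by
    rw [eulerTerm_apply, eulerTerm_apply, shifted_lie, lie_add, leibniz_lie (gen z) (gen y),
      lie_smul, ← he]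
    module
  rw [key, add_sub_assoc (e • _)]
  refine Submodule.add_mem _ (Submodule.smul_mem _ _ h1) ?_
  by_cases hyz : y = z
  · subst hyz
    have hM := lie_mem_weightFilt_of_not_isPos hy
      (shifted_mem_weightFilt hw (x := .M 1) Int.one_pos hv)
    have h2 : e * y.dualCoeff * genValue ψ (.M 1) = y.weight := by
      have := Gen.dualCoeff_ne_zero hz h0
      rw [he]; field_simp
    -- The scalar part of `M_1 = ψ(M_1) + (M_1 - ψ(M_1))` gives the main term; the remainder lowers
    -- the weight by 4.
    have h3 : e • ⁅gen y, ⁅⁅gen y.dual, gen y⁆, v⁆⁆ -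
        (if y = y then (y.weight : ℂ) else 0) • ⁅gen y, v⁆ =
        (e * y.dualCoeff) • ⁅gen y, shifted (gen (.M 1)) (genValue ψ (.M 1)) v⁆ := by
      rw [lie_gen, bracketGen_dual, if_pos rfl, ← h2, shifted_apply, lie_sub, smul_lie, lie_smul,
        lie_smul, M]
      module
    rw [h3]
    refine Submodule.smul_mem _ _ (weightFilt_mono w ?_ hM)
    simp only [Gen.drop]; omega
  · rw [if_neg hyz, zero_smul, sub_zero, lie_gen]
    exact Submodule.smul_mem _ _ (weightFilt_mono w (by omega) (lie_mem_weightFilt_of_not_isPos hz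
      (lie_mem_weightFilt hw (bracketGen_dual_mem_orderFilt hy hz hyz h0) hv)))

theorem euler_wordAct_mem (hψ : genValue ψ (.M 1) ≠ 0) (hw : IsWhittakerVector ψ w)
    {S : Finset Gen} (hS : ∀ z ∈ S, ¬ z.IsPos) {l : List Gen} (hl : ∀ g ∈ l, g ∈ S) :
    ∑ z ∈ S, eulerTerm ψ z (wordAct w l) - (wordWeight l : ℂ) • wordAct w l ∈
      weightFilt w (wordWeight l - 1) := by
  classical
  induction l with
  | nil =>
    have : ∑ z ∈ S, eulerTerm ψ z w = 0 := Finset.sum_eq_zero fun z hz => by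
      rw [eulerTerm_apply, hw.shifted_eq_zero (Gen.isPos_dual (hS z hz)), lie_zero, smul_zero]
    simp [wordWeight, wordAct, this]
  | cons y l ih =>
    simp only [List.mem_cons, forall_eq_or_imp] at hl
    have hy := hS y hl.1
    have h1 := lie_mem_weightFilt_of_not_isPos hy (ih hl.2)
    have hl' : wordAct w l ∈ weightFilt w (wordWeight l) :=
      wordAct_mem_weightFilt w (fun g hg => hS g (hl.2 g hg)) le_rfl
    have h2 := Submodule.sum_mem (t := S) _ fun z hz => eulerTerm_lie_mem hψ hw hy (hS z hz) hl'
    rw [Finset.sum_sub_distrib, Finset.sum_sub_distrib, ← Finset.sum_smul, Finset.sum_ite_eq,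
      if_pos hl.1] at h2
    rw [wordWeight_cons]
    rw [← add_sub_assoc, lie_sub, lie_smul, lie_sum] at h1
    have h3 := Submodule.add_mem _ h1 h2
    convert h3 using 1
    change ∑ z ∈ S, eulerTerm ψ z ⁅gen y, wordAct w l⁆ - _ • ⁅gen y, wordAct w l⁆ = _
    push_cast
    module

/-- The full Euler sum is infinite, but only the finitely many letters occurring in `v` matter.
Allowing every larger `S` lets the sets for two summands of `v` be merged. -/
theorem exists_euler_mem (hψ : genValue ψ (.M 1) ≠ 0) (hw : IsWhittakerVector ψ w) {N : ℤ} {v : V}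
    (hv : v ∈ weightFilt w N) : ∃ S₀ : Finset Gen, (∀ z ∈ S₀, ¬ z.IsPos) ∧
      ∀ S : Finset Gen, S₀ ⊆ S → (∀ z ∈ S, ¬ z.IsPos) →
        ∑ z ∈ S, eulerTerm ψ z v - (N : ℂ) • v ∈ weightFilt w (N - 1) := by
  classical
  induction hv using Submodule.span_induction with
  | mem x hx =>
    obtain ⟨l, hl, hN, rfl⟩ := hx
    refine ⟨l.toFinset, by simpa using hl, fun S hlS hS => ?_⟩
    have h1 := euler_wordAct_mem hψ hw hS (l := l) (fun g hg => hlS (List.mem_toFinset.mpr hg))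
    rcases hN.eq_or_lt with rfl | hN
    · exact h1
    -- For a word of weight below `N` the word and its image both lie in weight `N - 1`, so the
    -- eigenvalue is irrelevant.
    · have h2 : wordAct w l ∈ weightFilt w (N - 1) := wordAct_mem_weightFilt w hl (by omega)
      have h3 := (Submodule.sub_mem_iff_left _ (Submodule.smul_mem _ _ h2)).mp
        (weightFilt_mono w (N' := N - 1) (by omega) h1)
      exact Submodule.sub_mem _ h3 (Submodule.smul_mem _ _ h2)
  | zero => exact ⟨∅, by simp, fun S _ _ => by simp⟩
  | add x y _ _ hx hy =>
    obtain ⟨S, hS, hx⟩ := hx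
    obtain ⟨T, hT, hy⟩ := hy
    refine ⟨S ∪ T, fun z hz => (Finset.mem_union.mp hz).elim (hS z) (hT z), fun R hR h => ?_⟩
    have := Submodule.add_mem _ (hx R (Finset.union_subset_left hR) h)
      (hy R (Finset.union_subset_right hR) h)
    simp only [map_add, Finset.sum_add_distrib]
    convert this using 1
    module
  | smul c x _ hx =>
    obtain ⟨S, hS, hx⟩ := hx
    refine ⟨S, hS, fun R hR h => ?_⟩
    have := Submodule.smul_mem _ c (hx R hR h)
    simp only [map_smul, ← Finset.smul_sum]
    convert this using 1
    module

/-! ### Descent of Whittaker vectors through the filtration -/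

theorem IsWhittakerVector.mem_weightFilt_zero (hψ : genValue ψ (.M 1) ≠ 0)
    (hw : IsWhittakerVector ψ w) {v : V} (hv : IsWhittakerVector ψ v) {N : ℕ}
    (hN : v ∈ weightFilt w N) : v ∈ weightFilt w 0 := by
  induction N with
  | zero => simpa using hN
  | succ N ih =>
    obtain ⟨S, hS, h⟩ := exists_euler_mem hψ hw hN
    have h1 := h S subset_rfl hS
    -- Each summand kills `v`, so `(N + 1) v` has weight at most `N`, and `N + 1` is invertible.
    rw [Finset.sum_eq_zero fun z hz => by
      rw [eulerTerm_apply, hv.shifted_eq_zero (Gen.isPos_dual (hS z hz)), lie_zero, smul_zero],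
      zero_sub, Submodule.neg_mem_iff, Submodule.smul_mem_iff _ (by exact_mod_cast N.succ_ne_zero)]
      at h1
    exact ih (by simpa using h1)

theorem IsWhittakerVector.eq_zero_of_ne (hw : IsWhittakerVector ψ w)
    {ψ' : LieAlgebra.LieCharacter ℂ svPlus} (hne : ψ' ≠ ψ) {v : V} (hv : IsWhittakerVector ψ' v)
    {N : ℕ} (hN : v ∈ weightFilt w N) : v = 0 := by
  obtain ⟨g, hg, hval⟩ : ∃ g : Gen, g.IsPos ∧ genValue ψ' g ≠ genValue ψ g := by
    by_contra! h
    exact hne (lieCharacter_ext_genValue h)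
  have key : ∀ {k : ℤ}, v ∈ weightFilt w k → v ∈ weightFilt w (k - 1) := fun {k} hk => by
    have h1 := weightFilt_mono w (N' := k - 1) (by have := Gen.drop_pos hg; omega)
      (shifted_mem_weightFilt hw hg hk)
    have h2 := hv.shifted_eq_zero hg
    rw [shifted_apply, sub_eq_zero] at h2
    rw [shifted_apply, h2, ← sub_smul] at h1
    exact (Submodule.smul_mem_iff _ (sub_ne_zero.mpr hval)).mp h1
  -- One more descent from weight 0 reaches weight `-1`, where the filtration is zero.
  have h0 : v ∈ weightFilt w (-1) := by
    induction N with
    | zero => simpa using key hN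
    | succ N ih => exact ih (by simpa using key hN)
  simpa [weightFilt_eq_bot w (by norm_num : (-1 : ℤ) < 0)] using h0

theorem exists_lie_mem_weightFilt (hw : IsWhittakerVector ψ w) (x : SV) {v : V}
    (hv : ∃ N : ℕ, v ∈ weightFilt w N) : ∃ N : ℕ, ⁅x, v⁆ ∈ weightFilt w N := by
  obtain ⟨N, hN⟩ := hv
  obtain ⟨k, hk⟩ : ∃ k : ℕ, x ∈ orderFilt k := by
    have mono : ∀ {a b : ℕ}, a ≤ b → orderFilt a ≤ orderFilt b := fun {a b} hab =>
      Submodule.span_mono (Set.image_mono fun g (hg : g.order ≤ a) =>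
        show g.order ≤ b by omega)
    induction x using SV.induction with
    | hzero => exact ⟨0, Submodule.zero_mem _⟩
    | hadd x y hx hy =>
      obtain ⟨a, ha⟩ := hx
      obtain ⟨b, hb⟩ := hy
      exact ⟨max a b, Submodule.add_mem _ (mono (le_max_left a b) ha) (mono (le_max_right a b) hb)⟩
    | hsmul c g =>
      exact ⟨g.order.toNat, Submodule.smul_mem _ c (gen_mem_orderFilt (Int.self_le_toNat _))⟩
  exact ⟨N + k, by exact_mod_cast lie_mem_weightFilt hw hk hN⟩

end Filtration

/-! ### The universal Whittaker module -/

variable (ψ : LieAlgebra.LieCharacter ℂ svPlus)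

theorem UPlus_smul_CPsi (b : UPlus) (n : CPsi ψ) :
    b • n = (UniversalEnvelopingAlgebra.lift ℂ ψ b • n : CPsi ψ) := rfl

theorem mk_mul_inclU (a : U) (b : UPlus) (n : CPsi ψ) :
    (Submodule.Quotient.mk ((a * inclU b) ⊗ₜ[ℂ] n) : InducedModule inclU (CPsi ψ)) =
      Submodule.Quotient.mk (a ⊗ₜ[ℂ] (b • n)) :=
  (Submodule.Quotient.eq _).mpr (Submodule.subset_span ⟨a, b, n, rfl⟩)

theorem isWhittakerVector_w : IsWhittakerVector ψ (w ψ) := fun x => by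
  have h := mk_mul_inclU ψ 1 (UniversalEnvelopingAlgebra.ι ℂ x) (CPsi.one ψ)
  have h1 : inclU (UniversalEnvelopingAlgebra.ι ℂ x) = UniversalEnvelopingAlgebra.ι ℂ (x : SV) :=
    UniversalEnvelopingAlgebra.lift_ι_apply ℂ _ x
  rw [h1, UPlus_smul_CPsi, UniversalEnvelopingAlgebra.lift_ι_apply, TensorProduct.tmul_smul,
    one_mul] at h
  refine Eq.trans ?_ h
  refine congrArg Submodule.Quotient.mk ?_
  exact (TensorProduct.smul_tmul' _ _ _).trans (by rw [smul_eq_mul, mul_one])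

/-- By the universal property `ι` lifts to a map from `U` into the generated subalgebra; followed by
the inclusion it is the identity, so the inclusion is onto. -/
theorem adjoin_range_ι_eq_top :
    Algebra.adjoin ℂ (Set.range (UniversalEnvelopingAlgebra.ι ℂ : SV → U)) = ⊤ := by
  set A := Algebra.adjoin ℂ (Set.range (UniversalEnvelopingAlgebra.ι ℂ : SV → U)) with hA
  let _ : LieRing A := LieRing.ofAssociativeRing
  let _ : LieRing U := LieRing.ofAssociativeRing
  let f : SV →ₗ⁅ℂ⁆ A :=
    { toFun := fun x => ⟨UniversalEnvelopingAlgebra.ι ℂ x, Algebra.subset_adjoin ⟨x, rfl⟩⟩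
      map_add' := fun x y => Subtype.ext (map_add _ x y)
      map_smul' := fun c x => Subtype.ext (map_smul _ c x)
      map_lie' := fun {x y} => Subtype.ext (LieHom.map_lie _ x y) }
  have h : A.val.comp (UniversalEnvelopingAlgebra.lift ℂ f) = AlgHom.id ℂ U := by
    refine UniversalEnvelopingAlgebra.hom_ext ℂ (LieHom.ext fun x => ?_)
    change A.val (UniversalEnvelopingAlgebra.lift ℂ f (UniversalEnvelopingAlgebra.ι ℂ x)) = _
    rw [UniversalEnvelopingAlgebra.lift_ι_apply]
    rfl
  refine eq_top_iff.mpr fun u _ => ?_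
  rw [← AlgHom.id_apply (R := ℂ) u, ← h]
  exact Subtype.property _

theorem exists_smul_w_eq (v : W ψ) : ∃ u : U, u • w ψ = v := by
  obtain ⟨t, rfl⟩ := Submodule.Quotient.mk_surjective _ v
  induction t using TensorProduct.induction_on with
  | zero => exact ⟨0, zero_smul _ _⟩
  | tmul a n =>
    obtain ⟨c, rfl⟩ : ∃ c : ℂ, c • CPsi.one ψ = n := ⟨n, mul_one (M := ℂ) n⟩
    refine ⟨c • a, congrArg Submodule.Quotient.mk ?_⟩
    refine (TensorProduct.smul_tmul' _ _ _).trans ?_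
    rw [smul_eq_mul, mul_one, TensorProduct.smul_tmul]
  | add x y hx hy =>
    obtain ⟨a, ha⟩ := hx
    obtain ⟨b, hb⟩ := hy
    exact ⟨a + b, by rw [add_smul, ha, hb]; rfl⟩

theorem exists_mem_weightFilt (v : W ψ) : ∃ N : ℕ, v ∈ weightFilt (w ψ) N := by
  obtain ⟨u, rfl⟩ := exists_smul_w_eq ψ v
  have key : ∀ v : W ψ, (∃ N : ℕ, v ∈ weightFilt (w ψ) N) →
      ∃ N : ℕ, u • v ∈ weightFilt (w ψ) N := by
    have hu : u ∈ Algebra.adjoin ℂ (Set.range (UniversalEnvelopingAlgebra.ι ℂ : SV → U)) := by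
      rw [adjoin_range_ι_eq_top]; trivial
    induction hu using Algebra.adjoin_induction with
    | mem x hx =>
      obtain ⟨x, rfl⟩ := hx
      exact fun v hv => exists_lie_mem_weightFilt (isWhittakerVector_w ψ) x hv
    | algebraMap r =>
      rintro v ⟨N, hv⟩
      exact ⟨N, by rw [algebraMap_smul]; exact Submodule.smul_mem _ r hv⟩
    | add x y _ _ hx hy =>
      intro v hv
      obtain ⟨a, ha⟩ := hx v hv
      obtain ⟨b, hb⟩ := hy v hv
      refine ⟨max a b, ?_⟩
      rw [add_smul]
      exact Submodule.add_mem _ (weightFilt_mono _ (by omega) ha) (weightFilt_mono _ (by omega) hb)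
    | mul x y _ _ hx hy =>
      intro v hv
      rw [mul_smul]
      exact hx _ (hy v hv)
  exact key _ ⟨0, wordAct_mem_weightFilt (w ψ) (l := []) (by simp) (by simp [wordWeight])⟩

/-- Weights are nonnegative and only `M_0` has weight 0, so the spanning words are powers of `M_0`.
-/
theorem exists_polyM0_of_mem_weightFilt_zero {v : W ψ} (hv : v ∈ weightFilt (w ψ) 0) :
    ∃ u ∈ polyM0, v = u • w ψ := by
  induction hv using Submodule.span_induction with
  | mem x hx =>
    obtain ⟨l, hl, hN, rfl⟩ := hx
    induction l with
    | nil => exact ⟨1, one_mem _, (one_smul _ _).symm⟩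
    | cons g l ih =>
      simp only [List.mem_cons, forall_eq_or_imp] at hl
      rw [wordWeight_cons] at hN
      have h1 := Gen.weight_nonneg hl.1
      have h2 := wordWeight_nonneg hl.2
      obtain ⟨u, hu, h⟩ := ih hl.2 (by omega)
      obtain rfl := Gen.eq_of_weight_le_zero hl.1 (by omega)
      refine ⟨UniversalEnvelopingAlgebra.ι ℂ (M 0) * u,
        mul_mem (Algebra.subset_adjoin rfl) hu, ?_⟩
      rw [mul_smul, ← h]
      rfl
  | zero => exact ⟨0, zero_mem _, (zero_smul _ _).symm⟩
  | add x y _ _ hx hy =>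
    obtain ⟨a, ha, rfl⟩ := hx
    obtain ⟨b, hb, rfl⟩ := hy
    exact ⟨a + b, add_mem ha hb, (add_smul _ _ _).symm⟩
  | smul c x _ hx =>
    obtain ⟨a, ha, rfl⟩ := hx
    exact ⟨c • a, Subalgebra.smul_mem _ ha c, (smul_assoc _ _ _).symm⟩

/-! ### Centrality of `M_0` and the converse -/

theorem lie_M_zero (x : SV) : ⁅x, M 0⁆ = 0 := by
  induction x using SV.induction with
  | hzero => exact zero_lie _
  | hadd x y hx hy => rw [add_lie, hx, hy, add_zero]
  | hsmul c g =>
    rw [smul_lie, M, lie_gen]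
    rcases g with n | n | n <;> simp [bracketGen]

theorem commute_ι_of_mem_polyM0 {u : U} (hu : u ∈ polyM0) (x : SV) :
    UniversalEnvelopingAlgebra.ι ℂ x * u = u * UniversalEnvelopingAlgebra.ι ℂ x := by
  have h : polyM0 ≤ Subalgebra.centralizer ℂ {UniversalEnvelopingAlgebra.ι ℂ x} := by
    refine Algebra.adjoin_le (Set.singleton_subset_iff.mpr ?_)
    refine (Subalgebra.mem_centralizer_iff ℂ).mpr ?_
    rintro _ rfl
    let _ : LieRing U := LieRing.ofAssociativeRing
    rw [← sub_eq_zero, ← LieRing.of_associative_ring_bracket, ← LieHom.map_lie, lie_M_zero,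
      map_zero]
  exact (Subalgebra.mem_centralizer_iff ℂ).mp (h hu) _ rfl

theorem isWhittakerVector_polyM0_smul {u : U} (hu : u ∈ polyM0) :
    IsWhittakerVector ψ (u • w ψ) := fun x => by
  rw [lie_W, smul_smul, commute_ι_of_mem_polyM0 hu, mul_smul, ← lie_W, isWhittakerVector_w ψ x,
    ← algebraMap_smul U (ψ x), smul_smul, ← Algebra.commutes, mul_smul, algebraMap_smul]

end SchrodingerVirasoro

end

theorem theorem3p5 (ψ : LieAlgebra.LieCharacter ℂ SchrodingerVirasoro.svPlus)
    (hψ : SchrodingerVirasoro.IsNonsingular ψ) :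
    (∀ v : SchrodingerVirasoro.W ψ,
      SchrodingerVirasoro.IsWhittakerVector ψ v ↔
        ∃ u ∈ SchrodingerVirasoro.polyM0, v = u • SchrodingerVirasoro.w ψ) ∧
    (∀ ψ' : LieAlgebra.LieCharacter ℂ SchrodingerVirasoro.svPlus, ψ' ≠ ψ →
      ∀ v : SchrodingerVirasoro.W ψ,
        SchrodingerVirasoro.IsWhittakerVector ψ' v → v = 0) := by
  open SchrodingerVirasoro in
  have hw := isWhittakerVector_w ψ
  have hM : genValue ψ (.M 1) ≠ 0 := by
    rw [genValue_of_isPos ψ (g := .M 1) Int.one_pos]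
    exact hψ
  refine ⟨fun v => ⟨fun hv => ?_, ?_⟩, fun ψ' hne v hv => ?_⟩
  · obtain ⟨N, hN⟩ := exists_mem_weightFilt ψ v
    have h0 := IsWhittakerVector.mem_weightFilt_zero hM hw hv hN
    exact exists_polyM0_of_mem_weightFilt_zero ψ h0
  · rintro ⟨u, hu, rfl⟩
    exact isWhittakerVector_polyM0_smul ψ hu
  · obtain ⟨N, hN⟩ := exists_mem_weightFilt ψ v
    exact IsWhittakerVector.eq_zero_of_ne hw hne hv hN
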